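/- Let $G$ be a finite group and $d\ge 0$ an integer. For $n\ge 0$ let $G_n=G\wr\mathfrak S_n=G^n\rtimes\mathfrak S_n$ be the wreath product, where $\mathfrak S_n$ acts on $G^n$ by $s(g_1,\dots,g_n)=(g_{s^{-1}(1)},\dots,g_{s^{-1}(n)})$. For groups $K,H$ let $|\mathrm{Hom}(K,H)/H|$ be the number of $H$-conjugacy classes of homomorphisms $K\to H$; for $K=\mathbb Z^d$ this is the number of conjugacy classes of $d$-tuples of pairwise commuting elements of $H$. For $r\ge1$ let $j_r(\mathbb Z^d)$ be the number of subgroups of $\mathbb Z^d$ of index $r$. Then $$j_r(\mathbb Z^d)=\sum_{\substack{r_1,\dots,r_d\ge1\\ r_1r_2\cdots r_d=r}} r_2r_3^2\cdots r_d^{d-1}\qquad(r\ge1),$$ and, in the ring $\mathbb Z[[q]]$ of formal power series, where both infinite products converge (unconditionally) to the same invertible series, $$\sum_{n\ge0}q^n\,\bigl|\mathrm{Hom}(\mathbb Z^d,G_n)/G_n\bigr| =\Bigl[\prod_{r\ge1}(1-q^r)^{j_r(\mathbb Z^d)}\Bigr]^{-|\mathrm{Hom}(\mathbb Z^d,G)/G|}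 =\Bigl[\prod_{r_1,\dots,r_d\ge1}(1-q^{r_1\cdots r_d})^{r_2r_3^2\cdots r_d^{d-1}}\Bigr]^{-|\mathrm{Hom}(\mathbb Z^d,G)/G|}.$$ (For $d=0$ the index set of tuples consists of the empty tuple alone and empty products equal $1$.) -/

import Mathlib

open scoped PowerSeries PowerSeries.WithPiTopology

namespace WreathCount

/-- The action of `𝔖ₙ` on `Gⁿ` by automorphisms,
`s (g₁, …, gₙ) = (g_{s⁻¹ 1}, …, g_{s⁻¹ n})`. -/
def permAut (G : Type*) [Group G] (n : ℕ) :
    Equiv.Perm (Fin n) →* MulAut (Fin n → G) where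
  toFun s :=
    { toFun := fun g i => g (s⁻¹ i)
      invFun := fun g i => g (s i)
      left_inv := fun g => by ext i; simp
      right_inv := fun g => by ext i; simp
      map_mul' := fun _ _ => rfl }
  map_one' := rfl
  map_mul' s t := by ext g i; simp [mul_inv_rev]

/-- The wreath product `Gₙ = G ≀ 𝔖ₙ = Gⁿ ⋊ 𝔖ₙ`. -/
abbrev Wreath (G : Type*) [Group G] (n : ℕ) : Type _ :=
  (Fin n → G) ⋊[permAut G n] Equiv.Perm (Fin n)

/-- The free abelian group `ℤ^d`, written multiplicatively. -/
abbrev Zpow (d : ℕ) : Type := Multiplicative (Fin d → ℤ)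

/-- Conjugacy of homomorphisms: `φ ∼ ψ` if and only if there is a `g : G` with
`ψ x = g * φ x * g⁻¹` for all `x`. -/
def homConj (K G : Type*) [Group K] [Group G] : Setoid (K →* G) where
  r φ ψ := ∃ g : G, ∀ x : K, ψ x = g * φ x * g⁻¹
  iseqv :=
    { refl := fun φ => ⟨1, fun x => by simp⟩
      symm := by
        rintro φ ψ ⟨g, h⟩
        exact ⟨g⁻¹, fun x => by rw [h x]; group⟩
      trans := by
        rintro φ ψ χ ⟨g, h⟩ ⟨k, h'⟩
        exact ⟨k * g, fun x => by rw [h' x, h x]; group⟩ }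

/-- `|Hom(K, G)/G|`, the number of `G`-conjugacy classes of homomorphisms `K → G`. -/
noncomputable def numHomClasses (K G : Type*) [Group K] [Group G] : ℕ :=
  Nat.card (Quotient (homConj K G))

/-- `j_r(K)`, the number of subgroups of `K` of index `r` (used for `r ≥ 1` only). -/
noncomputable def numSubgroups (K : Type*) [Group K] (r : ℕ) : ℕ :=
  Nat.card {H : Subgroup K // H.index = r}

end WreathCount

/-!
A homomorphism `φ : A → G ≀ 𝔖ₙ` is the same thing as an action of `A` by automorphisms on the
trivial principal `G`-bundle `{1, …, n} × G` (`exists_wreathAct_eq`), and conjugate homomorphisms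
correspond to isomorphic bundles (`Bundle.exists_equiv_iff`). With `G` acting by right
multiplication by inverses, such a bundle is an `A × G`-set on which `G` acts freely with `n`
orbits, and every finite set of this kind arises (`Bundle.exists_equiv`). Finite `A × G`-sets are
classified by the multiset of the conjugacy classes of the stabilizers of their orbits
(`Decomposes`). Freeness under `G` means that stabilizers are graphs of homomorphisms `H → G` with
`H ≤ A` of finite index; as `A` is commutative, conjugacy in `A × G` fixes `H` and acts on the
homomorphism through `G`. Hence `|Hom(A, G_n)/G_n|` is the number of multisets of total size `n`
whose elements are pairs of a subgroup `H` and a class in `Hom(H, G)/G`, of size the index of `H`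
(`numHomClasses_wreath`).

The generating function of such multisets is the inverse of the product of `1 - q ^ size` over all
pairs (`mk_card_multiset_mul_eq_one`). For `A = ℤ^d` every `H` of finite index is again
isomorphic to `ℤ^d`, so there are `j_r(ℤ^d) |Hom(ℤ^d, G)/G|` pairs of size `r`
(`card_bundleType_size_eq`), which turns the product into the required power.

The formula for `j_r(ℤ^d)` follows by induction on `d`: a subgroup of index `n` in `A × ℤ` is
given by a factorisation `n = c r`, its intersection `K` with `A`, of index `r`, and the element
of `A ⧸ K` lying above the generator `c` of its projection to `ℤ` (`subgroupProdIntEquiv`).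
-/

namespace WreathCount

/-! ### Infinite products of `1 - q ^ k` and multisets -/

section EulerProduct

variable {T : Type*} (size : T → ℕ)

/-- Factors `1 - q ^ k` with `k > n` do not affect the `n`-th coefficient. -/
theorem coeff_mul_prod_one_sub_X_pow {n : ℕ} (A : ℤ⟦X⟧) (U : Finset T)
    (hU : ∀ t ∈ U, n < size t) :
    PowerSeries.coeff n (A * ∏ t ∈ U, (1 - (PowerSeries.X : ℤ⟦X⟧) ^ size t)) =
      PowerSeries.coeff n A := by
  classical
  induction U using Finset.induction_on with
  | empty => simp
  | insert t U ht ih =>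
    rw [Finset.prod_insert ht, ← ih fun t' h => hU t' (Finset.mem_insert_of_mem h)]
    rw [show ∀ a b c : ℤ⟦X⟧, a * ((1 - b) * c) = a * c - a * c * b by intros; ring, map_sub,
      PowerSeries.coeff_mul_X_pow', if_neg (by simpa using hU t (Finset.mem_insert_self _ _)),
      sub_zero]

/-- Once a finite set contains all indices of size at most `n`, the `n`-th coefficient of the
partial product `∏ (1 - q ^ size t)` is stationary; hence the infinite product converges. -/
theorem exists_hasProd_one_sub_X_pow (hfin : ∀ n, {t | size t ≤ n}.Finite) :
    ∃ R : ℤ⟦X⟧, HasProd (fun t => 1 - (PowerSeries.X : ℤ⟦X⟧) ^ size t) R := by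
  classical
  refine ⟨PowerSeries.mk fun n => PowerSeries.coeff n
    (∏ t ∈ (hfin n).toFinset, (1 - (PowerSeries.X : ℤ⟦X⟧) ^ size t)), ?_⟩
  rw [HasProd, PowerSeries.WithPiTopology.tendsto_iff_coeff_tendsto]
  intro n
  refine tendsto_const_nhds.congr' ?_
  simp only [SummationFilter.unconditional_filter]
  filter_upwards [Filter.eventually_ge_atTop (hfin n).toFinset] with S hS
  rw [PowerSeries.coeff_mk, ← Finset.prod_sdiff hS, mul_comm, coeff_mul_prod_one_sub_X_pow]
  intro t ht
  simpa using (Finset.mem_sdiff.1 ht).2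

/-- The geometric series `1 + q ^ k + q ^ (2 k) + ⋯`, for `k > 0`. -/
noncomputable def geomSeries (k : ℕ) : ℤ⟦X⟧ := PowerSeries.mk fun n => if k ∣ n then 1 else 0

theorem geomSeries_mul_one_sub {k : ℕ} (hk : 0 < k) :
    geomSeries k * (1 - (PowerSeries.X : ℤ⟦X⟧) ^ k) = 1 := by
  ext n
  rw [mul_sub, mul_one, map_sub, PowerSeries.coeff_mul_X_pow', geomSeries,
    PowerSeries.coeff_mk, PowerSeries.coeff_one]
  by_cases hn : k ≤ n
  · rw [if_pos hn, PowerSeries.coeff_mk, if_neg (show n ≠ 0 by omega)]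
    simp only [show k ∣ n - k ↔ k ∣ n from (Nat.dvd_sub_iff_left hn dvd_rfl), sub_self]
  · rw [if_neg hn]
    by_cases h0 : n = 0
    · simp [h0]
    · rw [if_neg h0, if_neg (fun h => hn (Nat.le_of_dvd (by omega) h)), sub_zero]

/-- Multisets of weight `n` are encoded by `l t = count t * size t`, which turns them into the
terms contributing to the `n`-th coefficient of a product of geometric series. -/
theorem coeff_prod_geomSeries (hpos : ∀ t, 0 < size t) {n : ℕ} (S : Finset T)
    (hS : ∀ t, size t ≤ n → t ∈ S) :
    PowerSeries.coeff n (∏ t ∈ S, geomSeries (size t)) =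
      (Nat.card {s : Multiset T // (s.map size).sum = n} : ℤ) := by
  classical
  rw [PowerSeries.coeff_prod]
  simp only [geomSeries, PowerSeries.coeff_mk]
  simp only [Finset.prod_boole]
  rw [Finset.sum_boole, Nat.cast_inj, ← Fintype.card_coe, ← Nat.card_eq_fintype_card]
  symm
  have key (s : Multiset T) (hs : (s.map size).sum = n) (t : T) (ht : t ∈ s) : t ∈ S :=
    hS t (hs ▸ Multiset.single_le_sum (by simp) _ (Multiset.mem_map_of_mem size ht))
  have hsum (s : Multiset T) (hs : ∀ t ∈ s, t ∈ S) :
      (s.map size).sum = ∑ t ∈ S, s.count t * size t := by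
    rw [Finset.sum_multiset_map_count]
    refine Finset.sum_subset (fun t ht => hs t (Multiset.mem_toFinset.1 ht)) fun t _ ht => ?_
    rw [Multiset.count_eq_zero.2 fun h => ht (Multiset.mem_toFinset.2 h), zero_smul]
  let f (s : {s : Multiset T // (s.map size).sum = n}) : T →₀ ℕ :=
    Finsupp.onFinset S (fun t => s.1.count t * size t) fun t ht =>
      key s.1 s.2 t (Multiset.count_ne_zero.1 (left_ne_zero_of_mul ht))
  refine Nat.card_congr (Equiv.ofBijective (fun s => ⟨f s, ?_⟩) ⟨?_, ?_⟩)
  · simp only [Finset.mem_filter, Finset.mem_finsuppAntidiag]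
    refine ⟨⟨?_, Finsupp.support_onFinset_subset⟩, fun t _ => Dvd.intro_left _ rfl⟩
    exact (hsum s.1 (key s.1 s.2)).symm.trans s.2
  · intro s s' h
    refine Subtype.ext (Multiset.ext.2 fun t => ?_)
    have := DFunLike.congr_fun (congrArg Subtype.val h) t
    exact Nat.eq_of_mul_eq_mul_right (hpos t) this
  · rintro ⟨l, hl⟩
    simp only [Finset.mem_filter, Finset.mem_finsuppAntidiag] at hl
    obtain ⟨⟨hl, hsupp⟩, hdvd⟩ := hl
    have hzero (t : T) (ht : t ∉ S) : l t = 0 :=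
      Finsupp.notMem_support_iff.1 fun h => ht (hsupp h)
    let g : T →₀ ℕ := Finsupp.onFinset S (fun t => l t / size t) fun t ht => by
      by_contra h
      simp [hzero t h] at ht
    have hg (t : T) : g t * size t = l t := by
      by_cases ht : t ∈ S
      · exact Nat.div_mul_cancel (hdvd t ht)
      · simp [g, hzero t ht]
    refine ⟨⟨Finsupp.toMultiset g, ?_⟩, ?_⟩
    · rw [hsum _ fun t ht => Finsupp.support_onFinset_subset ((Finsupp.mem_toMultiset g t).1 ht)]
      simpa only [Finsupp.count_toMultiset, hg] using hl
    · refine Subtype.ext (Finsupp.ext fun t => ?_)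
      simp [f, hg]

/-- The product of `(1 - q ^ size t)` over all `t` is inverse to the generating function of
multisets counted by total size. -/
theorem mk_card_multiset_mul_eq_one (hpos : ∀ t, 0 < size t)
    (hfin : ∀ n, {t | size t ≤ n}.Finite) {R : ℤ⟦X⟧}
    (hR : HasProd (fun t => 1 - (PowerSeries.X : ℤ⟦X⟧) ^ size t) R) :
    PowerSeries.mk (fun n => (Nat.card {s : Multiset T // (s.map size).sum = n} : ℤ)) * R = 1 := by
  classical
  have hM : Filter.Tendsto (fun S : Finset T => ∏ t ∈ S, geomSeries (size t)) Filter.atTop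
      (nhds (PowerSeries.mk
        fun n => (Nat.card {s : Multiset T // (s.map size).sum = n} : ℤ))) := by
    rw [PowerSeries.WithPiTopology.tendsto_iff_coeff_tendsto]
    intro n
    refine tendsto_const_nhds.congr' ?_
    filter_upwards [Filter.eventually_ge_atTop (hfin n).toFinset] with S hS
    rw [PowerSeries.coeff_mk, coeff_prod_geomSeries size hpos S]
    intro t ht
    exact hS (by simpa using ht)
  have hR' := hR
  rw [HasProd, SummationFilter.unconditional_filter] at hR'
  refine tendsto_nhds_unique (hM.mul hR') (tendsto_const_nhds.congr fun S => ?_)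
  rw [← Finset.prod_mul_distrib, Finset.prod_eq_one]
  exact fun t _ => geomSeries_mul_one_sub (hpos t)

/-- Grouping the factors of an unconditional product by their size. -/
theorem hasProd_one_sub_X_pow_fiberwise (hpos : ∀ t, 0 < size t)
    (hfin : ∀ n, {t | size t ≤ n}.Finite) {R : ℤ⟦X⟧}
    (hR : HasProd (fun t => 1 - (PowerSeries.X : ℤ⟦X⟧) ^ size t) R) :
    HasProd (fun r : ℕ+ => (1 - (PowerSeries.X : ℤ⟦X⟧) ^ (r : ℕ)) ^
      Nat.card {t // size t = r}) R := by
  let p (t : T) : ℕ+ := ⟨size t, hpos t⟩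
  have h := (Equiv.sigmaFiberEquiv p).hasProd_iff.2 hR
  refine HasProd.sigma h fun r => ?_
  have : Finite {t // p t = r} :=
    ((hfin r).subset fun t (ht : p t = r) => (congrArg PNat.val ht).le).to_subtype
  have := Fintype.ofFinite {t // p t = r}
  have hc : Nat.card {t // size t = r} = Fintype.card {t // p t = r} := by
    rw [← Nat.card_eq_fintype_card]
    exact Nat.card_congr (Equiv.subtypeEquivRight fun t => (PNat.coe_inj (m := p t)))
  convert hasProd_fintype _ using 1
  rw [hc, ← Finset.card_univ, ← Finset.prod_const]
  refine Finset.prod_congr rfl fun t _ => ?_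
  have ht : size t.1 = r := congrArg PNat.val t.2
  simp [Equiv.sigmaFiberEquiv, ht]

end EulerProduct

/-! ### Subgroups of finite index in `ℤ^d` -/

section Sublattices

variable {A : Type*} [CommGroup A]

/-- The subgroup of `A × ℤ` generated by `K × 0` and a lift of `(v, c)`, for `v : A ⧸ K`: it
consists of the pairs `(x, k c)` with `x` congruent to `v ^ k` modulo `K`. -/
def extendSubgroup (c : ℕ) (K : Subgroup A) (v : A ⧸ K) :
    Subgroup (A × Multiplicative ℤ) where
  carrier := {p | ∃ k : ℤ, Multiplicative.toAdd p.2 = k * c ∧ (p.1 : A ⧸ K) = v ^ k}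
  one_mem' := ⟨0, by simp⟩
  mul_mem' := by
    rintro p q ⟨k, hk, hk'⟩ ⟨l, hl, hl'⟩
    exact ⟨k + l, by simp [hk, hl, add_mul], by simp [hk', hl', zpow_add]⟩
  inv_mem' := by
    rintro p ⟨k, hk, hk'⟩
    exact ⟨-k, by simp [hk], by simp [hk']⟩

theorem mem_extendSubgroup {c : ℕ} {K : Subgroup A} {v : A ⧸ K}
    {p : A × Multiplicative ℤ} : p ∈ extendSubgroup c K v ↔
      ∃ k : ℤ, Multiplicative.toAdd p.2 = k * c ∧ (p.1 : A ⧸ K) = v ^ k := Iff.rfl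

theorem comap_inl_extendSubgroup {c : ℕ} (hc : 0 < c) (K : Subgroup A) (v : A ⧸ K) :
    (extendSubgroup c K v).comap (MonoidHom.inl A (Multiplicative ℤ)) = K := by
  ext x
  simp only [Subgroup.mem_comap, MonoidHom.inl_apply, mem_extendSubgroup, toAdd_one]
  constructor
  · rintro ⟨k, hk, hx⟩
    have : k = 0 := by simpa [hc.ne'] using hk.symm
    subst this
    simpa using hx
  · exact fun hx => ⟨0, by simp, by simpa using hx⟩

theorem mk_ofAdd_mem_extendSubgroup {c : ℕ} (hc : 0 < c) (K : Subgroup A) (v : A ⧸ K) (x : A) :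
    (x, Multiplicative.ofAdd (c : ℤ)) ∈ extendSubgroup c K v ↔ (x : A ⧸ K) = v := by
  simp only [mem_extendSubgroup, toAdd_ofAdd]
  constructor
  · rintro ⟨k, hk, hx⟩
    have : k = 1 := by
      have h : (k - 1) * (c : ℤ) = 0 := by linarith
      have hc' : (c : ℤ) ≠ 0 := by exact_mod_cast hc.ne'
      have := (mul_eq_zero.1 h).resolve_right hc'
      linarith
    simpa [this] using hx
  · exact fun hx => ⟨1, by simp, by simpa using hx⟩

theorem exists_mem_extendSubgroup_iff {c : ℕ} (K : Subgroup A) (v : A ⧸ K) (n : ℤ) :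
    (∃ x, (x, Multiplicative.ofAdd n) ∈ extendSubgroup c K v) ↔ (c : ℤ) ∣ n := by
  simp only [mem_extendSubgroup, toAdd_ofAdd]
  constructor
  · rintro ⟨x, k, hk, -⟩
    exact ⟨k, by rw [hk, mul_comm]⟩
  · rintro ⟨k, hk⟩
    obtain ⟨x, hx⟩ := QuotientGroup.mk_surjective (v ^ k)
    exact ⟨x, k, by rw [hk, mul_comm], hx⟩

/-- The chain `H ≤ H ⊔ A = A × cℤ ≤ A × ℤ` computes the index. -/
theorem index_extendSubgroup {c : ℕ} (hc : 0 < c) (K : Subgroup A) (v : A ⧸ K) :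
    (extendSubgroup c K v).index = c * K.index := by
  set H := extendSubgroup c K v
  let Z : Subgroup (Multiplicative ℤ) := AddSubgroup.toSubgroup (AddSubgroup.zmultiples (c : ℤ))
  have hZ : Z.index = c := by
    rw [AddSubgroup.index_toSubgroup, Int.index_zmultiples, Int.natAbs_natCast]
  have hM : (MonoidHom.inl A (Multiplicative ℤ)).range ⊔ H =
      Z.comap (MonoidHom.snd A (Multiplicative ℤ)) := by
    apply le_antisymm
    · rw [sup_le_iff]
      constructor
      · rintro _ ⟨x, rfl⟩
        exact Z.one_mem
      · rintro p ⟨k, hk, -⟩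
        exact AddSubgroup.mem_zmultiples_iff.2 ⟨k, by simp [hk]⟩
    · rintro ⟨x, n⟩ hn
      obtain ⟨k, hk⟩ := AddSubgroup.mem_zmultiples_iff.1 hn
      obtain ⟨y, hy⟩ := QuotientGroup.mk_surjective (v ^ k)
      have h1 : (x * y⁻¹, (1 : Multiplicative ℤ)) ∈
          (MonoidHom.inl A (Multiplicative ℤ)).range := ⟨x * y⁻¹, rfl⟩
      have h2 : (y, n) ∈ H := ⟨k, by simpa using hk.symm, hy⟩
      simpa using Subgroup.mul_mem_sup h1 h2
  rw [← Subgroup.relIndex_mul_index (show H ≤ Z.comap (MonoidHom.snd A (Multiplicative ℤ)) from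
    hM ▸ le_sup_right), Subgroup.index_comap_of_surjective _ Prod.snd_surjective, hZ, ← hM,
    Subgroup.relIndex_sup_right, ← Subgroup.index_comap, comap_inl_extendSubgroup hc, mul_comm]

/-- Every subgroup of finite index arises: take its intersection with `A`, the positive generator of
its projection to `ℤ`, and an element above that generator. -/
theorem exists_eq_extendSubgroup (H : Subgroup (A × Multiplicative ℤ)) (hH : H.index ≠ 0) :
    ∃ c : ℕ, 0 < c ∧ ∃ (K : Subgroup A) (v : A ⧸ K), extendSubgroup c K v = H := by
  obtain ⟨a, ha⟩ := Int.subgroup_cyclic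
    (Subgroup.toAddSubgroup' (H.map (MonoidHom.snd A (Multiplicative ℤ))))
  have hD (n : ℤ) : (∃ x, (x, Multiplicative.ofAdd n) ∈ H) ↔ (a.natAbs : ℤ) ∣ n := by
    rw [Int.natAbs_dvd, ← Int.mem_zmultiples_iff, AddSubgroup.zmultiples_eq_closure, ← ha,
      Subgroup.mem_toAddSubgroup', Subgroup.mem_map]
    constructor
    · rintro ⟨x, hx⟩
      exact ⟨_, hx, rfl⟩
    · rintro ⟨⟨x, m⟩, hx, rfl⟩
      exact ⟨x, hx⟩
  have hpos : 0 < a.natAbs := by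
    obtain ⟨k, hk, -, hkH⟩ := Subgroup.exists_pow_mem_of_index_ne_zero hH
      ((1 : A), Multiplicative.ofAdd (1 : ℤ))
    have hdvd := (hD k).1 ⟨1, by simpa [← ofAdd_nsmul] using hkH⟩
    exact Nat.pos_of_dvd_of_pos (Int.natCast_dvd_natCast.1 hdvd) hk
  obtain ⟨x, hx⟩ := (hD a.natAbs).2 dvd_rfl
  refine ⟨a.natAbs, hpos, H.comap (MonoidHom.inl A (Multiplicative ℤ)), (x : A ⧸ _), ?_⟩
  -- Modulo the `k`-th power of the generator `(x, c)`, membership reduces to the first factor.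
  have hred (y : A) (k : ℤ) :
      (y, Multiplicative.ofAdd (k * (a.natAbs : ℤ))) ∈ H ↔ (x ^ k)⁻¹ * y ∈
        H.comap (MonoidHom.inl A (Multiplicative ℤ)) := by
    have hk : ((x, Multiplicative.ofAdd (a.natAbs : ℤ)) ^ k)⁻¹ *
        (y, Multiplicative.ofAdd (k * (a.natAbs : ℤ))) =
        MonoidHom.inl A (Multiplicative ℤ) ((x ^ k)⁻¹ * y) :=
      Prod.ext rfl (inv_mul_eq_one.2 (by rw [Prod.pow_snd, ← ofAdd_zsmul, smul_eq_mul]))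
    rw [Subgroup.mem_comap, ← H.mul_mem_cancel_left (H.inv_mem (H.zpow_mem hx k)), hk]
  ext ⟨y, n⟩
  rw [mem_extendSubgroup]
  constructor
  · rintro ⟨k, hk, hy⟩
    obtain rfl : n = Multiplicative.ofAdd (k * (a.natAbs : ℤ)) := hk
    rw [hred]
    exact QuotientGroup.eq.1 hy.symm
  · intro h
    obtain ⟨k, hk⟩ := (hD (Multiplicative.toAdd n)).1 ⟨y, h⟩
    obtain rfl : n = Multiplicative.ofAdd (k * (a.natAbs : ℤ)) := by
      rw [mul_comm]; exact hk
    exact ⟨k, rfl, (QuotientGroup.eq.2 ((hred y k).1 h)).symm⟩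

/-- The data can be recovered: `c` from the projection to `ℤ`, `K` from the intersection with `A`,
and `v` from the elements above `c`. -/
theorem extendSubgroup_injective {c c' : ℕ} (hc : 0 < c) {K K' : Subgroup A} {v : A ⧸ K}
    {v' : A ⧸ K'} (h : extendSubgroup c K v = extendSubgroup c' K' v') :
    c = c' ∧ ∃ hK : K = K', hK ▸ v = v' := by
  have hcc : c = c' := by
    apply Nat.dvd_antisymm <;> rw [← Int.natCast_dvd_natCast]
    · rw [← exists_mem_extendSubgroup_iff K v, h, exists_mem_extendSubgroup_iff]
    · rw [← exists_mem_extendSubgroup_iff K' v', ← h, exists_mem_extendSubgroup_iff]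
  subst hcc
  have hK : K = K' := by
    rw [← comap_inl_extendSubgroup hc K v, h, comap_inl_extendSubgroup hc]
  subst hK
  obtain ⟨x, rfl⟩ := QuotientGroup.mk_surjective v
  exact ⟨rfl, rfl, (mk_ofAdd_mem_extendSubgroup hc K v' x).1 (h ▸
    (mk_ofAdd_mem_extendSubgroup hc K _ x).2 rfl)⟩


/-- A subgroup of index `n` in `A × ℤ` amounts to a factorisation `n = c * r`, a subgroup `K` of
index `r` in `A`, and an element of `A ⧸ K`. -/
noncomputable def subgroupProdIntEquiv (n : ℕ) (hn : n ≠ 0) :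
    (Σ p : n.divisorsAntidiagonal, Σ K : {K : Subgroup A // K.index = p.1.2}, A ⧸ K.1) ≃
      {H : Subgroup (A × Multiplicative ℤ) // H.index = n} := by
  have hmem (p : n.divisorsAntidiagonal) : p.1.1 * p.1.2 = n :=
    (Nat.mem_divisorsAntidiagonal.1 p.2).1
  have hpos (p : n.divisorsAntidiagonal) : 0 < p.1.1 :=
    Nat.pos_of_ne_zero (left_ne_zero_of_mul (hmem p ▸ hn))
  refine Equiv.ofBijective (fun q => ⟨extendSubgroup q.1.1.1 q.2.1.1 q.2.2, ?_⟩) ⟨?_, ?_⟩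
  · rw [index_extendSubgroup (hpos q.1), q.2.1.2, hmem]
  · rintro ⟨⟨⟨c, r⟩, hp⟩, ⟨K, hK⟩, v⟩ ⟨⟨⟨c', r'⟩, hp'⟩, ⟨K', hK'⟩, v'⟩ h
    obtain ⟨hc, hKK, hv⟩ := extendSubgroup_injective (hpos ⟨_, hp⟩) (congrArg Subtype.val h)
    dsimp only at hc hKK hv hK hK'
    subst hc hKK hv
    obtain rfl : r = r' := hK.symm.trans hK'
    rfl
  · rintro ⟨H, rfl⟩
    obtain ⟨c, hc, K, v, rfl⟩ := exists_eq_extendSubgroup H hn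
    exact ⟨⟨⟨(c, K.index), Nat.mem_divisorsAntidiagonal.2
      ⟨(index_extendSubgroup hc K v).symm, hn⟩⟩, ⟨K, rfl⟩, v⟩, rfl⟩

theorem finite_subgroup_prod_int (hA : ∀ r ≠ 0, Finite {K : Subgroup A // K.index = r})
    (n : ℕ) (hn : n ≠ 0) :
    Finite {H : Subgroup (A × Multiplicative ℤ) // H.index = n} ∧
      numSubgroups (A × Multiplicative ℤ) n =
        ∑ p ∈ n.divisorsAntidiagonal, numSubgroups A p.2 * p.2 := by
  have hr (p : n.divisorsAntidiagonal) : p.1.2 ≠ 0 :=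
    right_ne_zero_of_mul ((Nat.mem_divisorsAntidiagonal.1 p.2).1 ▸ hn)
  have (p : n.divisorsAntidiagonal) : Finite {K : Subgroup A // K.index = p.1.2} := hA _ (hr p)
  have (p : n.divisorsAntidiagonal) (K : {K : Subgroup A // K.index = p.1.2}) :
      Finite (A ⧸ K.1) := Nat.finite_of_card_ne_zero (by
    rw [← Subgroup.index_eq_card, K.2]; exact hr p)
  refine ⟨Finite.of_equiv _ (subgroupProdIntEquiv n hn), ?_⟩
  have (p : n.divisorsAntidiagonal) := Fintype.ofFinite {K : Subgroup A // K.index = p.1.2}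
  rw [numSubgroups, ← Nat.card_congr (subgroupProdIntEquiv n hn), Nat.card_sigma,
    ← Finset.sum_coe_sort n.divisorsAntidiagonal fun p => numSubgroups A p.2 * p.2]
  refine Finset.sum_congr rfl fun p _ => ?_
  rw [Nat.card_sigma, Finset.sum_congr rfl fun K _ => K.1.index_eq_card.symm.trans K.2,
    Finset.sum_const, Finset.card_univ, smul_eq_mul, numSubgroups, Nat.card_eq_fintype_card]

end Sublattices

/-- The splitting `ℤ^(d+1) ≃ ℤ^d × ℤ` that separates the first coordinate. -/
def zpowSuccEquiv (d : ℕ) : Zpow (d + 1) ≃* Zpow d × Multiplicative ℤ where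
  toFun x := (Multiplicative.ofAdd (Fin.tail x.toAdd), Multiplicative.ofAdd (x.toAdd 0))
  invFun p := Multiplicative.ofAdd (Fin.cons p.2.toAdd p.1.toAdd)
  left_inv x := by simp
  right_inv p := by simp
  map_mul' _ _ := rfl

/-- Subgroups of given index correspond under an isomorphism. -/
def subgroupIndexEquiv {K L : Type*} [Group K] [Group L] (e : K ≃* L) (r : ℕ) :
    {H : Subgroup K // H.index = r} ≃ {H : Subgroup L // H.index = r} :=
  Equiv.subtypeEquiv e.mapSubgroup.toEquiv fun H => by
    rw [← Subgroup.index_map_equiv H e]; rfl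

/-- Splitting off the factor `s 0`, which occurs with exponent `0`, raises every other exponent by
one and so contributes the factor `∏ i, s (i + 1)`. -/
theorem sum_finMulAntidiag_succ (d n : ℕ) (hn : n ≠ 0) :
    ∑ s ∈ Nat.finMulAntidiag (d + 1) n, ∏ i, s i ^ (i : ℕ) =
      ∑ p ∈ n.divisorsAntidiagonal,
        (∑ s ∈ Nat.finMulAntidiag d p.2, ∏ i, s i ^ (i : ℕ)) * p.2 := by
  simp_rw [Finset.sum_mul]
  rw [Finset.sum_sigma']
  symm
  refine Finset.sum_bij' (fun q _ => Fin.cons q.1.1 q.2)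
    (fun s _ => ⟨(s 0, ∏ i : Fin d, s i.succ), Fin.tail s⟩) ?_ ?_ ?_ ?_ ?_
  · rintro ⟨⟨c, r⟩, s⟩ h
    simp only [Finset.mem_sigma, Nat.mem_divisorsAntidiagonal, Nat.mem_finMulAntidiag] at h
    simp [Fin.prod_univ_succ, h.2.1, h.1.1, hn]
  · intro s h
    rw [Nat.mem_finMulAntidiag, Fin.prod_univ_succ] at h
    simp only [Finset.mem_sigma, Nat.mem_divisorsAntidiagonal, Nat.mem_finMulAntidiag]
    exact ⟨h, rfl, right_ne_zero_of_mul (h.1 ▸ hn)⟩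
  · rintro ⟨⟨c, r⟩, s⟩ h
    simp only [Finset.mem_sigma, Nat.mem_divisorsAntidiagonal, Nat.mem_finMulAntidiag] at h
    obtain ⟨-, rfl, -⟩ := h
    simp
  · intro s _
    simp
  · rintro ⟨⟨c, r⟩, s⟩ h
    simp only [Finset.mem_sigma, Nat.mem_divisorsAntidiagonal, Nat.mem_finMulAntidiag] at h
    simp [Fin.prod_univ_succ, pow_succ, Finset.prod_mul_distrib, h.2.1]

/-- The recursion `j_n(ℤ^(d+1)) = ∑_{c r = n} r j_r(ℤ^d)` evaluates `j_r(ℤ^d)`. -/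
theorem finite_subgroup_zpow (d : ℕ) : ∀ r ≠ 0,
    Finite {H : Subgroup (Zpow d) // H.index = r} ∧
      numSubgroups (Zpow d) r = ∑ s ∈ Nat.finMulAntidiag d r, ∏ i : Fin d, s i ^ (i : ℕ) := by
  induction d with
  | zero =>
    intro r hr
    have : Finite (Subgroup (Zpow 0)) := inferInstance
    refine ⟨inferInstance, ?_⟩
    have hidx (H : Subgroup (Zpow 0)) : H.index = 1 := by
      rw [Subsingleton.elim H ⊤, Subgroup.index_top]
    by_cases h1 : r = 1
    · subst h1
      rw [numSubgroups, Nat.card_congr (Equiv.subtypeUnivEquiv hidx), Nat.finMulAntidiag_one]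
      simp
    · rw [Nat.finMulAntidiag_zero_left h1, Finset.sum_empty, numSubgroups, Nat.card_eq_zero]
      exact Or.inl ⟨fun H => h1 (H.2.symm.trans (hidx H.1))⟩
  | succ d ih =>
    intro r hr
    obtain ⟨h1, h2⟩ := finite_subgroup_prod_int (fun r hr => (ih r hr).1) r hr
    let e := subgroupIndexEquiv (zpowSuccEquiv d) r
    refine ⟨Finite.of_equiv _ e.symm, ?_⟩
    rw [numSubgroups, Nat.card_congr e, ← numSubgroups, h2, sum_finMulAntidiag_succ d r hr]
    refine Finset.sum_congr rfl fun p hp => ?_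
    rw [(ih p.2 (right_ne_zero_of_mul ((Nat.mem_divisorsAntidiagonal.1 hp).1 ▸ hr))).2]

/-! ### Isomorphism types of finite `Γ`-sets -/

section Classification

variable {Γ : Type*} [Group Γ] {X Y : Type*} [MulAction Γ X] [MulAction Γ Y]

variable (Γ) in
/-- A family of points is a transversal if it meets every orbit exactly once. -/
def IsTransversal {I : Type*} (p : I → X) : Prop :=
  ∀ x, ∃! i, x ∈ MulAction.orbit Γ (p i)

theorem IsTransversal.smul_eq_smul_iff {I : Type*} {p : I → X} (hp : IsTransversal Γ p)
    {i j : I} {g h : Γ} :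
    g • p i = h • p j ↔ i = j ∧ h⁻¹ * g ∈ MulAction.stabilizer Γ (p i) := by
  constructor
  · intro hgh
    have hij : i = j := (hp (g • p i)).unique ⟨g, rfl⟩ ⟨h, hgh.symm⟩
    subst hij
    exact ⟨rfl, by rw [MulAction.mem_stabilizer_iff, mul_smul, hgh, inv_smul_smul]⟩
  · rintro ⟨rfl, hgh⟩
    rwa [MulAction.mem_stabilizer_iff, mul_smul, inv_smul_eq_iff] at hgh

/-- Two `Γ`-sets are isomorphic as soon as they have transversals with equal stabilizers: send
`g • p i` to `g • q i`. -/
theorem exists_equivariant_equiv {I : Type*} {p : I → X} {q : I → Y} (hp : IsTransversal Γ p)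
    (hq : IsTransversal Γ q)
    (h : ∀ i, MulAction.stabilizer Γ (p i) = MulAction.stabilizer Γ (q i)) :
    ∃ e : X ≃ Y, ∀ (g : Γ) (x : X), e (g • x) = g • e x := by
  have hiff {i j : I} {g g' : Γ} : g • p i = g' • p j ↔ g • q i = g' • q j := by
    rw [hp.smul_eq_smul_iff, hq.smul_eq_smul_iff, h]
  choose i hi using fun x => (hp x).exists
  -- `x = a x • p (i x)`, and likewise `y = b y • q (j y)`.
  choose a ha using hi
  choose j hj using fun y => (hq y).exists
  choose b hb using hj
  dsimp only at ha hb
  refine ⟨⟨fun x => a x • q (i x), fun y => b y • p (j y), fun x => ?_, fun y => ?_⟩,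
    fun g x => ?_⟩
  · exact (hiff.2 (hb _)).trans (ha x)
  · exact (hiff.1 (ha _)).trans (hb y)
  · change a (g • x) • q (i (g • x)) = g • a x • q (i x)
    rw [← mul_smul, ← hiff, ha, mul_smul, ha]

variable {T : Type*} (rep : T → Subgroup Γ)

/-- `Decomposes rep s X` says that the `Γ`-set `X` is isomorphic to the disjoint union of the
`Γ ⧸ rep t`, where `t` runs through the multiset `s`. This is expressed by a transversal whose
points have exactly the subgroups `rep t` as stabilizers. -/
def Decomposes (s : Multiset T) (X : Type*) [MulAction Γ X] : Prop :=
  ∃ (n : ℕ) (τ : Fin n → T) (p : Fin n → X), IsTransversal Γ p ∧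
    (∀ i, MulAction.stabilizer Γ (p i) = rep (τ i)) ∧ Finset.univ.val.map τ = s

/-- A finite `Γ`-set decomposes as soon as every stabilizer is conjugate to some `rep t`. -/
theorem exists_decomposes [Finite X]
    (hX : ∀ x : X, ∃ (t : T) (g : Γ), MulAction.stabilizer Γ (g • x) = rep t) :
    ∃ s, Decomposes rep s X := by
  obtain ⟨n, ⟨e⟩⟩ := Finite.exists_equiv_fin (MulAction.orbitRel.Quotient Γ X)
  choose t g hg using hX
  let out (i : Fin n) : X := (e.symm i).out
  refine ⟨_, n, fun i => t (out i), fun i => g (out i) • out i, fun x => ?_, fun i => hg _, rfl⟩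
  have hmem (i : Fin n) : x ∈ MulAction.orbit Γ (g (out i) • out i) ↔
      i = e (Quotient.mk (MulAction.orbitRel Γ X) x) := by
    rw [MulAction.orbit_smul, ← MulAction.orbitRel_apply,
      ← Quotient.eq (r := MulAction.orbitRel Γ X), Quotient.out_eq, ← Equiv.symm_apply_eq, eq_comm,
      Equiv.symm_symm]
  simp only [hmem, existsUnique_eq]

theorem exists_equiv_of_map_univ_eq {n n' : ℕ} {τ : Fin n → T} {τ' : Fin n' → T}
    (h : Finset.univ.val.map τ = Finset.univ.val.map τ') :
    ∃ σ : Fin n ≃ Fin n', ∀ i, τ' (σ i) = τ i := by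
  classical
  have hcard (t : T) : Nonempty ({i // τ i = t} ≃ {i // τ' i = t}) := by
    have := congrArg (Multiset.count t) h
    rw [Multiset.count_map, Multiset.count_map] at this
    refine ⟨Fintype.equivOfCardEq ?_⟩
    rw [Fintype.card_subtype, Fintype.card_subtype]
    simp only [eq_comm (a := t)] at this
    exact this
  refine ⟨Equiv.ofFiberEquiv fun t => (hcard t).some, fun i => Equiv.ofFiberEquiv_map _ i⟩

theorem Decomposes.exists_equivariant_equiv {s : Multiset T} (hX : Decomposes rep s X)
    (hY : Decomposes rep s Y) : ∃ e : X ≃ Y, ∀ (g : Γ) (x : X), e (g • x) = g • e x := by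
  obtain ⟨n, τ, p, hp, hpτ, hs⟩ := hX
  obtain ⟨n', τ', q, hq, hqτ, hs'⟩ := hY
  obtain ⟨σ, hσ⟩ := exists_equiv_of_map_univ_eq (hs.trans hs'.symm)
  refine WreathCount.exists_equivariant_equiv (q := q ∘ σ) hp (fun y => ?_) fun i => ?_
  · obtain ⟨j, hj, huniq⟩ := hq y
    exact ⟨σ.symm j, by simpa using hj, fun i hi => (σ.eq_symm_apply).2 (huniq _ hi)⟩
  · rw [hpτ, Function.comp_apply, hqτ, hσ]

/-- If the `rep t` are pairwise non-conjugate, the multiset of types is an invariant of the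
`Γ`-set: two transversals are matched by the orbits they meet. -/
theorem Decomposes.unique
    (hrep : ∀ (t t' : T) (g : Γ), (rep t).map (MulAut.conj g).toMonoidHom = rep t' → t = t')
    {s s' : Multiset T} (hX : Decomposes rep s X) (hX' : Decomposes rep s' X) : s = s' := by
  obtain ⟨n, τ, p, hp, hpτ, rfl⟩ := hX
  obtain ⟨n', τ', q, hq, hqτ, rfl⟩ := hX'
  choose σ hσ using fun i => (hq (p i)).exists
  choose ρ hρ using fun i => (hp (q i)).exists
  have hρσ (i) : ρ (σ i) = i :=
    (hp (p i)).unique (MulAction.orbit_eq_iff.2 (hρ (σ i)) ▸ hσ i) (MulAction.mem_orbit_self _)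
  have hσρ (i) : σ (ρ i) = i :=
    (hq (q i)).unique (MulAction.orbit_eq_iff.2 (hσ (ρ i)) ▸ hρ i) (MulAction.mem_orbit_self _)
  have hτ : τ = τ' ∘ (⟨σ, ρ, hρσ, hσρ⟩ : Fin n ≃ Fin n') := by
    funext i
    obtain ⟨g, hg⟩ := hσ i
    dsimp only at hg
    refine (hrep _ _ g ?_).symm
    change (rep (τ' (σ i))).map _ = _
    rw [← hqτ, ← MulAction.stabilizer_smul_eq_stabilizer_map_conj, hg, hpτ]
  rw [hτ, ← Multiset.map_map]
  congr 1
  exact congrArg Finset.val (Finset.map_univ_equiv (⟨σ, ρ, hρσ, hσρ⟩ : Fin n ≃ Fin n'))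

theorem Decomposes.of_equiv {s : Multiset T} (hX : Decomposes rep s X) (e : X ≃ Y)
    (he : ∀ (g : Γ) (x : X), e (g • x) = g • e x) : Decomposes rep s Y := by
  obtain ⟨n, τ, p, hp, hpτ, hs⟩ := hX
  refine ⟨n, τ, e ∘ p, fun y => ?_, fun i => ?_, hs⟩
  · refine (existsUnique_congr fun i => ?_).1 (hp (e.symm y))
    simp only [MulAction.mem_orbit_iff, Function.comp_apply, ← he, e.eq_symm_apply]
  · rw [← hpτ]
    ext g
    simp only [MulAction.mem_stabilizer_iff, Function.comp_apply, ← he, e.apply_eq_iff_eq]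

/-- The disjoint union of the `Γ ⧸ rep (τ i)` realizes any prescribed multiset of types. -/
theorem decomposes_sigma {n : ℕ} (τ : Fin n → T) :
    Decomposes rep (Finset.univ.val.map τ) (Σ i, Γ ⧸ rep (τ i)) := by
  refine ⟨n, τ, fun i => ⟨i, ((1 : Γ) : Γ ⧸ rep (τ i))⟩, ?_, fun i => ?_, rfl⟩
  · rintro ⟨i, x⟩
    obtain ⟨g, rfl⟩ := QuotientGroup.mk_surjective x
    refine ⟨i, ⟨g, ?_⟩, ?_⟩
    · simp [Sigma.smul_mk]
    · rintro j ⟨h, hj⟩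
      exact congrArg Sigma.fst hj
  · rw [← MulAction.stabilizer_quotient (rep (τ i))]
    ext g
    rw [MulAction.mem_stabilizer_iff, MulAction.mem_stabilizer_iff, Sigma.smul_mk,
      Sigma.mk.inj_iff, heq_eq_eq, and_iff_right rfl]

theorem Decomposes.card_eq [Finite X] {s : Multiset T} (hX : Decomposes rep s X) :
    Nat.card X = (s.map fun t => (rep t).index).sum := by
  obtain ⟨n, τ, p, hp, hpτ, rfl⟩ := id hX
  obtain ⟨e, -⟩ := hX.exists_equivariant_equiv rep (decomposes_sigma rep τ)
  have hfin (i : Fin n) : Finite (Γ ⧸ rep (τ i)) :=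
    Finite.of_injective (fun x => e.symm ⟨i, x⟩) fun x y h => by simpa using h
  rw [Nat.card_congr e, Nat.card_sigma, Multiset.map_map]
  rfl

theorem exists_decomposes_type (hfin : ∀ t, (rep t).index ≠ 0) (s : Multiset T) :
    ∃ (n : ℕ) (τ : Fin n → T), Finset.univ.val.map τ = s ∧ Finite (Σ i, Γ ⧸ rep (τ i)) := by
  induction s using Quotient.inductionOn with
  | h l =>
    have hf (t : T) : Finite (Γ ⧸ rep t) := Nat.finite_of_card_ne_zero (hfin t)
    refine ⟨l.length, l.get, ?_, inferInstance⟩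
    simp

end Classification

/-! ### Graphs of homomorphisms as stabilizers -/

section Graph

variable {A : Type*} [CommGroup A] {G : Type*} [Group G]

/-- The graph in `A × G` of a homomorphism defined on a subgroup of `A`. -/
def graphOn (H : Subgroup A) (θ : H →* G) : Subgroup (A × G) := (H.subtype.prod θ).range

theorem mem_graphOn {H : Subgroup A} {θ : H →* G} {a : A} {g : G} :
    (a, g) ∈ graphOn H θ ↔ ∃ ha : a ∈ H, θ ⟨a, ha⟩ = g := by
  constructor
  · rintro ⟨h, hh⟩
    obtain ⟨rfl, rfl⟩ := Prod.mk_inj.1 hh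
    exact ⟨h.2, rfl⟩
  · rintro ⟨ha, rfl⟩
    exact ⟨⟨a, ha⟩, rfl⟩

/-- The pairs `(a, g)`, with `a` in a set of representatives of `A ⧸ H`, represent all cosets of the
graph. -/
theorem index_graphOn (H : Subgroup A) (θ : H →* G) :
    (graphOn H θ).index = H.index * Nat.card G := by
  rw [Subgroup.index_eq_card, Subgroup.index_eq_card, ← Nat.card_prod]
  refine (Nat.card_congr (Equiv.ofBijective
    (fun p : (A ⧸ H) × G => (((p.1.out, p.2) : A × G) : (A × G) ⧸ graphOn H θ)) ⟨?_, ?_⟩)).symm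
  · rintro ⟨c, g⟩ ⟨c', g'⟩ h
    obtain ⟨hc, hg⟩ := mem_graphOn.1 (QuotientGroup.eq.1 h)
    have hcc : c = c' := by
      rw [← QuotientGroup.out_eq' c, ← QuotientGroup.out_eq' c']
      exact QuotientGroup.eq.2 hc
    subst hcc
    have h1 : (⟨_, hc⟩ : H) = 1 := Subtype.ext (inv_mul_cancel _)
    rw [h1, map_one] at hg
    exact Prod.ext rfl (inv_mul_eq_one.1 hg.symm)
  · intro x
    obtain ⟨⟨a, g⟩, rfl⟩ := QuotientGroup.mk_surjective x
    have ha : ((a : A ⧸ H).out)⁻¹ * a ∈ H := QuotientGroup.eq.1 (QuotientGroup.out_eq' _)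
    refine ⟨((a : A ⧸ H), g * (θ ⟨_, ha⟩)⁻¹), QuotientGroup.eq.2 (mem_graphOn.2 ⟨ha, ?_⟩)⟩
    simp

theorem map_conj_graphOn (H : Subgroup A) (θ : H →* G) (p : A × G) :
    (graphOn H θ).map (MulAut.conj p).toMonoidHom =
      graphOn H ((MulAut.conj p.2).toMonoidHom.comp θ) := by
  rw [graphOn, graphOn, MonoidHom.map_range]
  congr 1
  ext h <;> simp

theorem graphOn_inj {H : Subgroup A} {θ θ' : H →* G} :
    graphOn H θ = graphOn H θ' ↔ θ = θ' := by
  refine ⟨fun h => MonoidHom.ext fun a => ?_, fun h => h ▸ rfl⟩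
  exact (mem_graphOn.1 (h ▸ mem_graphOn.2 ⟨a.2, rfl⟩ : ((a : A), θ a) ∈ graphOn H θ')).2.symm

theorem map_fst_graphOn (H : Subgroup A) (θ : H →* G) :
    (graphOn H θ).map (MonoidHom.fst A G) = H := by
  rw [graphOn, MonoidHom.map_range]
  exact H.range_subtype

/-- A subgroup of `A × G` meeting `1 × G` trivially is the graph of a homomorphism. -/
theorem exists_eq_graphOn (L : Subgroup (A × G)) (hL : ∀ g, ((1 : A), g) ∈ L → g = 1) :
    ∃ θ : L.map (MonoidHom.fst A G) →* G, graphOn _ θ = L := by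
  have huniq {a : A} {g g' : G} (h : (a, g) ∈ L) (h' : (a, g') ∈ L) : g = g' := by
    refine (inv_mul_eq_one.1 (hL _ ?_))
    simpa using L.mul_mem (L.inv_mem h) h'
  have hex (a : L.map (MonoidHom.fst A G)) : ∃ g, ((a : A), g) ∈ L := by
    obtain ⟨_, ⟨a, g⟩, h, rfl⟩ := a
    exact ⟨g, h⟩
  choose f hf using hex
  refine ⟨MonoidHom.mk' f fun a b => huniq (hf (a * b)) (L.mul_mem (hf a) (hf b)), ?_⟩
  ext ⟨a, g⟩
  rw [mem_graphOn]
  constructor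
  · rintro ⟨ha, rfl⟩
    exact hf ⟨a, ha⟩
  · intro h
    exact ⟨⟨_, h, rfl⟩, huniq (hf _) h⟩

variable (A G) in
/-- The isomorphism types of transitive `A`-equivariant principal `G`-bundles with finite base:
the base is `A ⧸ H`, and the bundle is given by the conjugacy class of a homomorphism `H → G`. -/
abbrev BundleType : Type _ :=
  Σ H : {H : Subgroup A // H.index ≠ 0}, Quotient (homConj H.1 G)

/-- The number of points of the base `A ⧸ H`. -/
noncomputable def BundleType.size (t : BundleType A G) : ℕ := t.1.1.index

/-- A stabilizer in the `A × G`-set of type `t`; it is determined up to conjugacy. -/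
noncomputable def BundleType.stab (t : BundleType A G) : Subgroup (A × G) :=
  graphOn t.1.1 t.2.out

theorem BundleType.size_pos (t : BundleType A G) : 0 < t.size := Nat.pos_of_ne_zero t.1.2

theorem BundleType.index_stab (t : BundleType A G) : t.stab.index = t.size * Nat.card G :=
  index_graphOn _ _

/-- The standard stabilizers of different types are not conjugate; commutativity of `A` enters here.
-/
theorem BundleType.eq_of_map_conj_stab (t t' : BundleType A G) (p : A × G)
    (h : t.stab.map (MulAut.conj p).toMonoidHom = t'.stab) : t = t' := by
  obtain ⟨⟨H, hH⟩, c⟩ := t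
  obtain ⟨⟨H', hH'⟩, c'⟩ := t'
  rw [stab, stab, map_conj_graphOn] at h
  dsimp only at h
  obtain rfl : H = H' := (map_fst_graphOn H _).symm.trans (h ▸ map_fst_graphOn H' c'.out)
  rw [graphOn_inj] at h
  refine Sigma.ext rfl (heq_of_eq ?_)
  rw [← Quotient.out_eq c, ← Quotient.out_eq c']
  exact Quotient.sound (s := homConj H G) ⟨p.2, fun x => (DFunLike.congr_fun h x).symm⟩

/-- In a finite `A × G`-set on which `G` acts freely, every stabilizer is conjugate to one of the
standard subgroups. -/
theorem exists_stabilizer_eq_stab {X : Type*} [MulAction (A × G) X] [Finite X]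
    (hfree : ∀ (x : X) (g : G), ((1 : A), g) • x = x → g = 1) (x : X) :
    ∃ (t : BundleType A G) (p : A × G), MulAction.stabilizer (A × G) (p • x) = t.stab := by
  obtain ⟨θ, hθ⟩ := exists_eq_graphOn (MulAction.stabilizer (A × G) x) (hfree x)
  have hfin : (MulAction.stabilizer (A × G) x).index ≠ 0 := by
    rw [Subgroup.index_eq_card, ← Nat.card_congr (MulAction.orbitEquivQuotientStabilizer _ x)]
    have : Nonempty (MulAction.orbit (A × G) x) := ⟨⟨x, MulAction.mem_orbit_self x⟩⟩
    exact Nat.card_pos.ne'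
  have hH : ((MulAction.stabilizer (A × G) x).map (MonoidHom.fst A G)).index ≠ 0 := fun h =>
    hfin (Nat.eq_zero_of_zero_dvd (h ▸ Subgroup.index_map_dvd _ Prod.fst_surjective))
  obtain ⟨g, hg⟩ := Quotient.exact (s := homConj _ G)
    (Quotient.out_eq (Quotient.mk (homConj _ G) θ)).symm
  refine ⟨⟨⟨_, hH⟩, Quotient.mk _ θ⟩, (1, g), ?_⟩
  rw [MulAction.stabilizer_smul_eq_stabilizer_map_conj]
  conv_lhs => rw [← hθ]
  rw [map_conj_graphOn, BundleType.stab, graphOn_inj]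
  exact MonoidHom.ext fun a => (hg a).symm

end Graph

/-! ### The wreath product as the automorphism group of a trivial bundle -/

section WreathAction

variable {A : Type*} [CommGroup A] {G : Type*} [Group G] {n : ℕ}

/-- The action of `G ≀ 𝔖ₙ` on the trivial principal bundle `{1, …, n} × G`. -/
def wreathAct (w : Wreath G n) (p : Fin n × G) : Fin n × G :=
  (w.right p.1, w.left (w.right p.1) * p.2)

theorem wreathAct_one (p : Fin n × G) : wreathAct 1 p = p := by
  simp [wreathAct]

theorem wreathAct_mul (w w' : Wreath G n) (p : Fin n × G) :
    wreathAct (w * w') p = wreathAct w (wreathAct w' p) := by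
  simp [wreathAct, permAut, mul_assoc]

theorem wreathAct_mul_right (w : Wreath G n) (i : Fin n) (x g : G) :
    ((wreathAct w (i, x)).1, (wreathAct w (i, x)).2 * g) = wreathAct w (i, x * g) := by
  simp [wreathAct, mul_assoc]

theorem wreathAct_injective {w w' : Wreath G n}
    (h : ∀ p : Fin n × G, wreathAct w p = wreathAct w' p) : w = w' := by
  have hr : w.right = w'.right := Equiv.ext fun i => congrArg Prod.fst (h (i, 1))
  refine SemidirectProduct.ext (funext fun i => ?_) hr
  have := congrArg Prod.snd (h (w.right⁻¹ i, 1))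
  simpa [wreathAct, ← hr] using this

/-- `G ≀ 𝔖ₙ` is the full automorphism group of the trivial bundle. -/
theorem exists_wreathAct_eq (f : Fin n × G ≃ Fin n × G)
    (hf : ∀ (i : Fin n) (x g : G), f (i, x * g) = ((f (i, x)).1, (f (i, x)).2 * g)) :
    ∃ w : Wreath G n, ∀ p, wreathAct w p = f p := by
  have hf1 (i : Fin n) (g : G) : f (i, g) = ((f (i, 1)).1, (f (i, 1)).2 * g) := by
    simpa using hf i 1 g
  have hbij : Function.Bijective fun i => (f (i, 1)).1 := by
    apply Function.Surjective.bijective_of_finite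
    intro j
    obtain ⟨⟨i, g⟩, h⟩ := f.surjective (j, 1)
    rw [hf1] at h
    exact ⟨i, congrArg Prod.fst h⟩
  let σ : Equiv.Perm (Fin n) := Equiv.ofBijective _ hbij
  refine ⟨⟨fun j => (f (σ.symm j, 1)).2, σ⟩, fun ⟨i, g⟩ => ?_⟩
  rw [hf1]
  simp only [wreathAct, σ.symm_apply_apply]
  rfl

/-- The trivial bundle `{1, …, n} × G` with the action of `A × G` given by `φ : A → G ≀ 𝔖ₙ`, where
`g : G` acts by right multiplication by `g⁻¹`. -/
def Bundle (_ : A →* Wreath G n) : Type _ := Fin n × G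

instance (φ : A →* Wreath G n) : MulAction (A × G) (Bundle φ) where
  smul p x := wreathAct (φ p.1) (x.1, x.2 * p.2⁻¹)
  one_smul x := by
    change wreathAct (φ 1) (x.1, x.2 * 1⁻¹) = x
    rw [map_one, wreathAct_one, inv_one, mul_one]
    rfl
  mul_smul p q x := by
    change wreathAct (φ (p.1 * q.1)) (x.1, x.2 * (p.2 * q.2)⁻¹) =
      wreathAct (φ p.1) ((wreathAct (φ q.1) (x.1, x.2 * q.2⁻¹)).1,
        (wreathAct (φ q.1) (x.1, x.2 * q.2⁻¹)).2 * p.2⁻¹)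
    rw [map_mul, wreathAct_mul]
    simp [wreathAct, mul_assoc]

theorem Bundle.smul_def (φ : A →* Wreath G n) (p : A × G) (i : Fin n) (x : G) :
    (p • (show Bundle φ from (i, x)) : Bundle φ) = wreathAct (φ p.1) (i, x * p.2⁻¹) := rfl

instance [Finite G] (φ : A →* Wreath G n) : Finite (Bundle φ) :=
  inferInstanceAs (Finite (Fin n × G))

theorem Bundle.card (φ : A →* Wreath G n) : Nat.card (Bundle φ) = n * Nat.card G := by
  change Nat.card (Fin n × G) = _
  rw [Nat.card_prod, Nat.card_fin]

theorem Bundle.free (φ : A →* Wreath G n) (x : Bundle φ) (g : G)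
    (h : ((1 : A), g) • x = x) : g = 1 := by
  obtain ⟨i, x⟩ := x
  have h' := (Bundle.smul_def φ (1, g) i x).symm.trans h
  rw [map_one, wreathAct_one] at h'
  simpa using congrArg Prod.snd h'

/-- Isomorphisms of bundles over `A × G` are elements of `G ≀ 𝔖ₙ` conjugating `φ` into `ψ`. -/
theorem Bundle.exists_equiv_iff (φ ψ : A →* Wreath G n) :
    (∃ e : Bundle φ ≃ Bundle ψ, ∀ (p : A × G) x, e (p • x) = p • e x) ↔
      (homConj A (Wreath G n)).r φ ψ := by
  constructor
  · rintro ⟨e, he⟩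
    have hG (i : Fin n) (x g : G) : e (i, x * g) = ((e (i, x)).1, (e (i, x)).2 * g) := by
      have h := he (1, g⁻¹) (i, x)
      have h1 := Bundle.smul_def φ (1, g⁻¹) i x
      have h2 := Bundle.smul_def ψ (1, g⁻¹) (e (i, x)).1 (e (i, x)).2
      rw [map_one, wreathAct_one, inv_inv] at h1 h2
      rw [← h1]
      exact h.trans h2
    obtain ⟨w, hw⟩ := exists_wreathAct_eq (f := e) hG
    refine ⟨w, fun a => eq_mul_inv_of_mul_eq (wreathAct_injective fun p => ?_)⟩
    rw [wreathAct_mul, wreathAct_mul, hw, hw]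
    have h := he (a, 1) p
    have h1 := Bundle.smul_def φ (a, 1) p.1 p.2
    have h2 := Bundle.smul_def ψ (a, 1) (e p).1 (e p).2
    rw [inv_one, mul_one] at h1 h2
    exact h2.symm.trans (h.symm.trans (congrArg e h1))
  · rintro ⟨w, hw⟩
    refine ⟨⟨wreathAct w, wreathAct w⁻¹, fun p => ?_, fun p => ?_⟩, fun p x => ?_⟩
    · exact (wreathAct_mul w⁻¹ w p).symm.trans (by rw [inv_mul_cancel]; exact wreathAct_one p)
    · exact (wreathAct_mul w w⁻¹ p).symm.trans (by rw [mul_inv_cancel]; exact wreathAct_one p)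
    · obtain ⟨i, x⟩ := x
      change wreathAct w (wreathAct (φ p.1) (i, x * p.2⁻¹)) =
        wreathAct (ψ p.1) ((wreathAct w (i, x)).1, (wreathAct w (i, x)).2 * p.2⁻¹)
      rw [hw, wreathAct_mul_right, ← wreathAct_mul, ← wreathAct_mul, inv_mul_cancel_right]

/-- Every finite `A × G`-set with free action of `G` and `n` orbits under `G` comes from a
homomorphism `A → G ≀ 𝔖ₙ`. -/
theorem Bundle.exists_equiv [Finite G] {Y : Type*} [MulAction (A × G) Y] [Finite Y]
    (hfree : ∀ (y : Y) (g : G), ((1 : A), g) • y = y → g = 1)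
    (hcard : Nat.card Y = n * Nat.card G) :
    ∃ (φ : A →* Wreath G n) (e : Bundle φ ≃ Y), ∀ (p : A × G) x, e (p • x) = p • e x := by
  let instG : MulAction G Y := MulAction.compHom Y (MonoidHom.inr A G)
  let Ω := MulAction.orbitRel.Quotient G Y
  have hbij : Function.Bijective fun p : Ω × G => p.2⁻¹ • p.1.out := by
    constructor
    · rintro ⟨ω, x⟩ ⟨ω', x'⟩ h
      dsimp only at h
      have hω : ω = ω' := by
        rw [← Quotient.out_eq ω, ← Quotient.out_eq ω']
        refine Quotient.sound (s := MulAction.orbitRel G Y) ⟨x * x'⁻¹, ?_⟩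
        change (x * x'⁻¹) • ω'.out = ω.out
        rw [mul_smul, ← h, smul_inv_smul]
      subst hω
      rw [inv_smul_eq_iff, ← mul_smul, eq_comm] at h
      exact Prod.ext rfl (mul_inv_eq_one.1 (hfree _ _ h))
    · intro y
      obtain ⟨g, hg⟩ := Quotient.exact (s := MulAction.orbitRel G Y)
        (Quotient.out_eq (Quotient.mk (MulAction.orbitRel G Y) y)).symm
      exact ⟨(Quotient.mk _ y, g⁻¹), by simpa using hg⟩
  have hΩ : Nat.card Ω = n := by
    have h := Nat.card_congr (Equiv.ofBijective _ hbij)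
    rw [Nat.card_prod, hcard] at h
    exact Nat.eq_of_mul_eq_mul_right Nat.card_pos h
  have : Finite Ω := Quotient.finite _
  let c : Fin n ≃ Ω := (Finite.equivFinOfCardEq hΩ).symm
  let E : Fin n × G ≃ Y := (Equiv.prodCongr c (Equiv.refl G)).trans (Equiv.ofBijective _ hbij)
  have hE (i : Fin n) (x g : G) : E (i, x * g) = ((1 : A), g⁻¹) • E (i, x) := by
    change (x * g)⁻¹ • (c i).out = g⁻¹ • x⁻¹ • (c i).out
    rw [mul_inv_rev, mul_smul]
  -- `F a` is the action of `a` transported to the trivial bundle.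
  let F (a : A) : Fin n × G ≃ Fin n × G :=
    (E.trans (MulAction.toPerm (a, (1 : G)))).trans E.symm
  have hEF (a : A) (p) : E (F a p) = (a, (1 : G)) • E p := E.apply_symm_apply _
  have hF (a : A) : ∃ w : Wreath G n, ∀ p, wreathAct w p = F a p := by
    refine exists_wreathAct_eq (F a) fun i x g => E.injective ?_
    rw [hE, hEF, hE, hEF, ← mul_smul, ← mul_smul]
    simp
  choose w hw using hF
  let φ : A →* Wreath G n := MonoidHom.mk' w fun a b => wreathAct_injective fun p => by
    rw [wreathAct_mul, hw, hw, hw]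
    refine E.injective ?_
    rw [hEF, hEF, hEF, ← mul_smul]
    simp
  refine ⟨φ, E, fun p x => ?_⟩
  obtain ⟨i, x⟩ := x
  rw [Bundle.smul_def]
  change E (wreathAct (w p.1) (i, x * p.2⁻¹)) = _
  rw [hw, hEF, hE, ← mul_smul, Prod.mk_mul_mk, mul_one, one_mul, inv_inv]
  rfl

end WreathAction

/-! ### Counting -/

section Counting

theorem finite_monoidHom_of_fg (K G : Type*) [Group K] [Group.FG K] [Group G] [Finite G] :
    Finite (K →* G) := by
  obtain ⟨S, hS⟩ := Group.fg_def.1 ‹Group.FG K›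
  refine Finite.of_injective (fun (φ : K →* G) (x : S) => φ x) fun φ ψ h => ?_
  exact MonoidHom.eq_of_eqOn_dense hS fun x hx => congrFun h ⟨x, hx⟩

theorem numHomClasses_congr {K L : Type*} [Group K] [Group L] (e : K ≃* L) (G : Type*) [Group G] :
    numHomClasses K G = numHomClasses L G := by
  refine Nat.card_congr (Quotient.congr (e.monoidHomCongrLeftEquiv (N := G)) fun φ ψ => ?_)
  refine exists_congr fun g => ?_
  rw [← e.symm.forall_congr_right]
  rfl

variable {A : Type*} [CommGroup A] {G : Type*} [Group G] [Finite G]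

/-- Conjugacy classes of homomorphisms to `G ≀ 𝔖ₙ` are multisets of bundle types of total size
`n`, since an `n`-sheeted bundle is determined by the types of its restrictions to the orbits. -/
theorem numHomClasses_wreath (n : ℕ) :
    numHomClasses A (Wreath G n) =
      Nat.card {s : Multiset (BundleType A G) // (s.map BundleType.size).sum = n} := by
  have hex (φ : A →* Wreath G n) :
      ∃ s, Decomposes (BundleType.stab (A := A) (G := G)) s (Bundle φ) :=
    exists_decomposes _ (exists_stabilizer_eq_stab (Bundle.free φ))
  have hsize (s : Multiset (BundleType A G)) :
      (s.map fun t => t.stab.index).sum = (s.map BundleType.size).sum * Nat.card G := by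
    rw [← Multiset.sum_map_mul_right]
    exact congrArg Multiset.sum (Multiset.map_congr rfl fun t _ => t.index_stab)
  choose s hs using hex
  have hsum (φ : A →* Wreath G n) : ((s φ).map BundleType.size).sum = n := by
    have h := (hs φ).card_eq
    rw [Bundle.card, hsize] at h
    exact (Nat.eq_of_mul_eq_mul_right Nat.card_pos h).symm
  -- `s φ` lists the types of the orbits of the bundle given by `φ`.
  refine Nat.card_congr (Equiv.ofBijective
    (Quotient.lift (fun φ => ⟨s φ, hsum φ⟩) fun φ ψ h => Subtype.ext ?_) ⟨?_, ?_⟩)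
  · obtain ⟨e, he⟩ := (Bundle.exists_equiv_iff φ ψ).2 h
    exact ((hs φ).of_equiv _ e he).unique _ BundleType.eq_of_map_conj_stab (hs ψ)
  · rintro ⟨φ⟩ ⟨ψ⟩ h
    have h' : s φ = s ψ := congrArg Subtype.val h
    exact Quotient.sound ((Bundle.exists_equiv_iff φ ψ).1
      ((hs φ).exists_equivariant_equiv _ (h' ▸ hs ψ)))
  · rintro ⟨m, hm⟩
    obtain ⟨k, τ, rfl, hfin⟩ := exists_decomposes_type (BundleType.stab (A := A) (G := G))
      (fun t => by rw [t.index_stab]; exact (Nat.mul_pos t.size_pos Nat.card_pos).ne') m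
    have hY := decomposes_sigma (BundleType.stab (A := A) (G := G)) τ
    have hfree (y : Σ i, (A × G) ⧸ (τ i).stab) (g : G) (h : ((1 : A), g) • y = y) : g = 1 := by
      obtain ⟨i, x⟩ := y
      obtain ⟨⟨a, x⟩, rfl⟩ := QuotientGroup.mk_surjective x
      rw [Sigma.smul_mk, Sigma.mk.inj_iff, heq_eq_eq, and_iff_right rfl] at h
      have h' := QuotientGroup.eq.1 h.symm
      obtain ⟨ha, hx⟩ := mem_graphOn.1 h'
      have h1 : (⟨_, ha⟩ : (τ i).1.1) = 1 := Subtype.ext (by simp)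
      rw [h1, map_one] at hx
      have hx' : x⁻¹ * (g * x) = 1 := by simpa using hx.symm
      exact mul_eq_right.1 (inv_mul_eq_one.1 hx').symm
    have hcard : Nat.card (Σ i, (A × G) ⧸ (τ i).stab) = n * Nat.card G := by
      rw [hY.card_eq, hsize, hm]
    obtain ⟨φ, e, he⟩ := Bundle.exists_equiv hfree hcard
    refine ⟨Quotient.mk _ φ, Subtype.ext ?_⟩
    exact ((hs φ).of_equiv _ e he).unique _ BundleType.eq_of_map_conj_stab hY

/-- If every subgroup of finite index is isomorphic to `A`, there are equally many bundle types over
each `A ⧸ H`. -/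
theorem card_bundleType_size_eq [Group.FG A]
    (hA : ∀ H : Subgroup A, H.index ≠ 0 → Nonempty (H ≃* A)) {r : ℕ} (hr : r ≠ 0)
    (hfin : Finite {H : Subgroup A // H.index = r}) :
    Finite {t : BundleType A G // t.size = r} ∧
      Nat.card {t : BundleType A G // t.size = r} = numSubgroups A r * numHomClasses A G := by
  let e : {t : BundleType A G // t.size = r} ≃
      Σ H : {H : Subgroup A // H.index = r}, Quotient (homConj H.1 G) :=
    { toFun := fun t => ⟨⟨t.1.1.1, t.2⟩, t.1.2⟩
      invFun := fun t => ⟨⟨⟨t.1.1, fun h => hr (t.1.2.symm.trans h)⟩, t.2⟩, t.1.2⟩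
      left_inv := fun _ => rfl
      right_inv := fun _ => rfl }
  have hiso (H : {H : Subgroup A // H.index = r}) : Nonempty (H.1 ≃* A) :=
    hA H.1 fun h => hr (H.2.symm.trans h)
  have (H : {H : Subgroup A // H.index = r}) : Finite (Quotient (homConj H.1 G)) := by
    obtain ⟨f⟩ := hiso H
    have := finite_monoidHom_of_fg A G
    have : Finite (H.1 →* G) := Finite.of_equiv _ (f.monoidHomCongrLeftEquiv (N := G)).symm
    exact Quotient.finite _
  refine ⟨Finite.of_equiv _ e.symm, ?_⟩
  have := Fintype.ofFinite {H : Subgroup A // H.index = r}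
  rw [Nat.card_congr e, Nat.card_sigma,
    Finset.sum_congr rfl fun (H : {H : Subgroup A // H.index = r}) _ =>
    (show Nat.card (Quotient (homConj H.1 G)) = numHomClasses A G from
      numHomClasses_congr (hiso H).some G),
    Finset.sum_const, Finset.card_univ, smul_eq_mul, numSubgroups, Nat.card_eq_fintype_card]

/-- Grouping the tuples `(r₁, …, r_d)` by their product identifies the two infinite products. -/
theorem exists_hasProd_zpow (d : ℕ) : ∃ P : ℤ⟦X⟧,
    HasProd (fun r : ℕ+ =>
      (1 - (PowerSeries.X : ℤ⟦X⟧) ^ (r : ℕ)) ^ numSubgroups (Zpow d) (r : ℕ)) P ∧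
    HasProd (fun s : Fin d → ℕ+ =>
      (1 - (PowerSeries.X : ℤ⟦X⟧) ^ (∏ i : Fin d, (s i : ℕ))) ^
        (∏ i : Fin d, (s i : ℕ) ^ (i : ℕ))) P := by
  -- The exponents are absorbed by repeating each factor.
  let I : Type := Σ s : Fin d → ℕ+, Fin (∏ i : Fin d, (s i : ℕ) ^ (i : ℕ))
  let size (q : I) : ℕ := ∏ i, (q.1 i : ℕ)
  have hpos (q : I) : 0 < size q := Finset.prod_pos fun i _ => (q.1 i).pos
  have hfin (n : ℕ) : {q | size q ≤ n}.Finite := by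
    refine Set.Finite.preimage' (f := Sigma.fst) (s := Set.Iic fun _ : Fin d => n.succPNat) ?_ ?_
      |>.subset ?_
    · exact Set.finite_Iic _
    · rintro s -
      refine (Set.finite_range (Sigma.mk s)).subset ?_
      rintro ⟨s, k⟩ rfl
      exact ⟨k, rfl⟩
    · intro q hq i
      rw [← PNat.coe_le_coe, Nat.succPNat_coe]
      exact (Nat.le_of_dvd (hpos q) (Finset.dvd_prod_of_mem _ (Finset.mem_univ i))).trans
        (Nat.le_succ_of_le hq)
  obtain ⟨P, hP⟩ := exists_hasProd_one_sub_X_pow size hfin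
  refine ⟨P, ?_, ?_⟩
  · convert hasProd_one_sub_X_pow_fiberwise size hpos hfin hP using 3 with r
    let e : {q // size q = r} ≃
        Σ s : Nat.finMulAntidiag d r, Fin (∏ i : Fin d, s.1 i ^ (i : ℕ)) :=
      { toFun := fun q => ⟨⟨fun i => q.1.1 i, Nat.mem_finMulAntidiag.2 ⟨q.2, r.pos.ne'⟩⟩, q.1.2⟩
        invFun := fun q => ⟨⟨fun i => ⟨q.1.1 i, Nat.pos_of_ne_zero
          (Nat.ne_zero_of_mem_finMulAntidiag q.1.2 i)⟩, q.2⟩,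
          Nat.prod_eq_of_mem_finMulAntidiag q.1.2⟩
        left_inv := fun _ => rfl
        right_inv := fun _ => rfl }
    rw [Nat.card_congr e, Nat.card_sigma, (finite_subgroup_zpow d r r.pos.ne').2,
      ← Finset.sum_coe_sort]
    simp only [Nat.card_fin]
  · refine HasProd.sigma hP fun s => ?_
    have h := hasProd_fintype (fun _ : Fin (∏ i : Fin d, (s i : ℕ) ^ (i : ℕ)) =>
      1 - (PowerSeries.X : ℤ⟦X⟧) ^ (∏ i : Fin d, (s i : ℕ)))
    rw [Finset.prod_const, Finset.card_univ, Fintype.card_fin] at h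
    exact h

/-- The product over all bundle types is both the inverse of the generating function and a power
of the Euler product `∏ (1 - q ^ r) ^ j_r`; in particular the latter is invertible. -/
theorem exists_unit_hasProd_and_mk_numHomClasses_eq (G : Type*) [Group G] [Finite G] (d : ℕ) :
    ∃ P : (ℤ⟦X⟧)ˣ,
      HasProd (fun r : ℕ+ =>
          (1 - (PowerSeries.X : ℤ⟦X⟧) ^ (r : ℕ)) ^
            numSubgroups (Zpow d) (r : ℕ))
        (P : ℤ⟦X⟧) ∧
      HasProd (fun s : Fin d → ℕ+ =>
          (1 - (PowerSeries.X : ℤ⟦X⟧) ^ (∏ i : Fin d, (s i : ℕ))) ^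
            (∏ i : Fin d, (s i : ℕ) ^ (i : ℕ)))
        (P : ℤ⟦X⟧) ∧
      PowerSeries.mk (fun n : ℕ =>
          (numHomClasses (Zpow d) (Wreath G n) : ℤ)) =
        ((P ^ (-(numHomClasses (Zpow d) G : ℤ)) : (ℤ⟦X⟧)ˣ) : ℤ⟦X⟧) := by
  have hsub := finite_subgroup_zpow d
  obtain ⟨P, hP, hP'⟩ := exists_hasProd_zpow d
  have hFG : Group.FG (Zpow d) := inferInstance
  have hiso (H : Subgroup (Zpow d)) (hH : H.index ≠ 0) : Nonempty (H ≃* Zpow d) := by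
    rw [← Subgroup.index_toAddSubgroup] at hH
    obtain ⟨e⟩ := (Int.addSubgroup_index_ne_zero_iff (H := Subgroup.toAddSubgroup' H)).1 hH
    exact ⟨AddEquiv.toMultiplicative e⟩
  have htype (r : ℕ) (hr : r ≠ 0) := card_bundleType_size_eq (G := G) hiso hr (hsub r hr).1
  have hpos (t : BundleType (Zpow d) G) := t.size_pos
  have hfin (n : ℕ) : {t : BundleType (Zpow d) G | t.size ≤ n}.Finite := by
    refine Set.Finite.preimage' (Set.finite_Ioc 0 n) (fun r hr => ?_) |>.subset
      fun t ht => ⟨t.size_pos, ht⟩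
    exact Set.finite_coe_iff.1 (htype r hr.1.ne').1
  obtain ⟨R, hR⟩ := exists_hasProd_one_sub_X_pow BundleType.size hfin
  have hMR := mk_card_multiset_mul_eq_one BundleType.size hpos hfin hR
  have hRP : R = P ^ numHomClasses (Zpow d) G := by
    refine (hasProd_one_sub_X_pow_fiberwise BundleType.size hpos hfin hR).unique ?_
    convert hP.pow (numHomClasses (Zpow d) G) using 2 with r
    rw [(htype r r.pos.ne').2, pow_mul]
  -- The exponent is nonzero, so invertibility of the power gives invertibility of `P`.
  have hm : numHomClasses (Zpow d) G ≠ 0 := by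
    have := finite_monoidHom_of_fg (Zpow d) G
    have : Finite (Quotient (homConj (Zpow d) G)) := Quotient.finite _
    exact Nat.card_pos.ne'
  have hPu : IsUnit P := by
    rw [← isUnit_pow_iff hm, ← hRP]
    exact IsUnit.of_mul_eq_one_right _ hMR
  obtain ⟨P, rfl⟩ := hPu
  refine ⟨P, hP, hP', ?_⟩
  simp only [numHomClasses_wreath]
  rw [zpow_neg, zpow_natCast]
  refine Units.eq_inv_of_mul_eq_one_left ?_
  rw [Units.val_pow_eq_pow_val, ← hRP, mul_comm, hMR]

end Counting

end WreathCount

theorem mainTheorem4 (G : Type*) [Group G] [Finite G] (d : ℕ) :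
    (∀ r : ℕ, 1 ≤ r →
      WreathCount.numSubgroups (WreathCount.Zpow d) r =
        ∑ s ∈ Nat.finMulAntidiag d r, ∏ i : Fin d, s i ^ (i : ℕ)) ∧
    ∃ P : (ℤ⟦X⟧)ˣ,
      HasProd (fun r : ℕ+ =>
          (1 - (PowerSeries.X : ℤ⟦X⟧) ^ (r : ℕ)) ^
            WreathCount.numSubgroups (WreathCount.Zpow d) (r : ℕ))
        (P : ℤ⟦X⟧) ∧
      HasProd (fun s : Fin d → ℕ+ =>
          (1 - (PowerSeries.X : ℤ⟦X⟧) ^ (∏ i : Fin d, (s i : ℕ))) ^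
            (∏ i : Fin d, (s i : ℕ) ^ (i : ℕ)))
        (P : ℤ⟦X⟧) ∧
      PowerSeries.mk (fun n : ℕ =>
          (WreathCount.numHomClasses (WreathCount.Zpow d) (WreathCount.Wreath G n) : ℤ)) =
        ((P ^ (-(WreathCount.numHomClasses (WreathCount.Zpow d) G : ℤ)) : (ℤ⟦X⟧)ˣ) : ℤ⟦X⟧) :=
  ⟨fun r hr => (WreathCount.finite_subgroup_zpow d r (Nat.one_le_iff_ne_zero.1 hr)).2,
    WreathCount.exists_unit_hasProd_and_mk_numHomClasses_eq G d⟩
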